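/- Let $K$ be a field of characteristic different from $2$. By a $K$-variety we mean a separated scheme of finite type over $K$, and $K_0(\mathrm{Var}_K)$ denotes the Grothendieck ring of varieties: the free abelian group on isomorphism classes $[X]$ of $K$-varieties modulo the relations $[X]=[Z]+[X\setminus Z]$ for every closed immersion $Z\hookrightarrow X$, with multiplication induced by the product over $K$. Put $\mathbb{L}=[\mathbb{A}^1_K]$. For an integer $n\ge 0$ and an integer $k$, let $\mathrm{Sym}^{n,k}$ be the variety of symmetric $n\times n$ matrices of rank $k$ over $K$, that is, the open complement of $\mathrm{Sym}^{n,\le k-1}$ in $\mathrm{Sym}^{n,\le k}$, where $\mathrm{Sym}^{n,\le k}$ is the closed subscheme of the affine space $\mathbb{A}^{n(n+1)/2}_K$ of symmetric $n\times n$ matrices defined by the vanishing of all $(k+1)\times(k+1)$ minors (so $\mathrm{Sym}^{n,\le k}=\mathrm{Sym}^{n,k}=\emptyset$ for $k<0$, and $\mathrm{Sym}^{n,k}=\emptyset$ for $k>n$). Then for all integers $0<k\le n$, in $K_0(\mathrm{Var}_K)$, $$[\mathrm{Sym}^{n,k}]=(\mathbb{L}^n-\mathbb{L}^{k-1})\,[\mathrm{Sym}^{n-1,k-2}]+(\mathbb{L}^{k}-\mathbb{L}^{k-1})\,[\mathrm{Sym}^{n-1,k-1}]+\mathbb{L}^{k}\,[\mathrm{Sym}^{n-1,k}].$$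 -/

import Mathlib

open CategoryTheory AlgebraicGeometry MonoidalCategory

universe u

noncomputable section

/-! ### Varieties over a field and their Grothendieck ring -/

/-- A `K`-variety is a separated scheme of finite type over `K`. -/
def isVariety (K : Type u) [Field K] : ObjectProperty (Over (Spec (CommRingCat.of K))) :=
  fun X => IsSeparated X.hom ∧ LocallyOfFiniteType X.hom ∧ QuasiCompact X.hom

/-- Varieties are closed under fibre products over `K` and contain `Spec K`. -/
instance isVariety_isMonoidal (K : Type u) [Field K] : (isVariety K).IsMonoidal where
  prop_unit := by
    change IsSeparated (𝟙 (Spec (CommRingCat.of K))) ∧ LocallyOfFiniteType (𝟙 _) ∧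
      QuasiCompact (𝟙 _)
    exact ⟨inferInstance, inferInstance, inferInstance⟩
  prop_tensor X Y hX hY := by
    obtain ⟨_, _, _⟩ := hX
    obtain ⟨_, _, _⟩ := hY
    rw [isVariety, Over.tensorObj_hom]
    exact ⟨inferInstance, inferInstance, inferInstance⟩

/-- The category `Var_K` of `K`-varieties and `K`-morphisms, with the fibre product over `K` as
its (cartesian) monoidal structure. -/
abbrev Var (K : Type u) [Field K] := (isVariety K).FullSubcategory

/-- The scissor relations `[X] - [Z] - [U]`, for `Z ⟶ X` a closed immersion of varieties and
`U ⟶ X` an open immersion onto its complement, in the free abelian group on isomorphism classes of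
varieties. The product of this free abelian group is the one that extends
`[X] * [Y] = [X ×_K Y]` bilinearly. -/
def scissorRelations (K : Type u) [Field K] : Set (FreeAbelianGroup (Skeleton (Var K))) :=
  {r | ∃ (X Z U : Var K) (i : Z ⟶ X) (j : U ⟶ X),
    IsClosedImmersion i.hom.left ∧ IsOpenImmersion j.hom.left ∧
    Set.range j.hom.left = (Set.range i.hom.left)ᶜ ∧
    r = FreeAbelianGroup.of (toSkeleton X) - FreeAbelianGroup.of (toSkeleton Z)
      - FreeAbelianGroup.of (toSkeleton U)}

/-- The Grothendieck ring `K₀(Var_K)`. The ideal spanned by the scissor relations is also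
the additive subgroup that they generate, since the product with a variety `W` turns the relation
of `Z ⊆ X` into that of `W ×_K Z ⊆ W ×_K X`. -/
abbrev K0Var (K : Type u) [Field K] :=
  FreeAbelianGroup (Skeleton (Var K)) ⧸ Ideal.span (scissorRelations K)

/-- The class `[X]` of a variety `X` in `K₀(Var_K)`. -/
def varClass {K : Type u} [Field K] (X : Var K) : K0Var K :=
  Ideal.Quotient.mk _ (FreeAbelianGroup.of (toSkeleton X))

/-- The affine line over `K`. -/
def affineLine (K : Type u) [Field K] : Var K where
  obj := Over.mk (𝔸(PUnit.{u + 1}; Spec (CommRingCat.of K)) ↘ Spec (CommRingCat.of K))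
  property := by
    dsimp only [isVariety, Over.mk_hom]
    exact ⟨inferInstance, inferInstance, inferInstance⟩

/-- The Lefschetz motive `𝕃 = [𝔸¹]`. -/
def lefschetz (K : Type u) [Field K] : K0Var K := varClass (affineLine K)

/-! ### Symmetric matrices of fixed rank -/

/-- The coordinate ring of the affine space of dimension `n (n + 1) / 2` of symmetric
`n × n` matrices: one variable for each unordered pair of indices. -/
abbrev SymCoord (K : Type u) [Field K] (n : ℕ) := MvPolynomial (Sym2 (Fin n)) K

/-- The generic symmetric `n × n` matrix. -/
def genericSym (K : Type u) [Field K] (n : ℕ) : Matrix (Fin n) (Fin n) (SymCoord K n) :=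
  Matrix.of fun i j => MvPolynomial.X s(i, j)

/-- The ideal generated by the `m × m` minors of the generic symmetric matrix. (Row or column
choices with a repetition contribute `0`, and reordering only changes signs.) -/
def minorIdeal (K : Type u) [Field K] (n m : ℕ) : Ideal (SymCoord K n) :=
  Ideal.span (Set.range fun rc : (Fin m → Fin n) × (Fin m → Fin n) =>
    ((genericSym K n).submatrix rc.1 rc.2).det)

/-- The coordinate ring of the closed subscheme `Sym^{n,≤k}` of symmetric matrices of rank at most
`k`, cut out by the minors of size `k + 1`. For `k < 0` the `0 × 0` minor `1` makes it zero. -/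
abbrev SymLECoord (K : Type u) [Field K] (n : ℕ) (k : ℤ) :=
  SymCoord K n ⧸ minorIdeal K n (k + 1).toNat

/-- The open subscheme of `Sym^{n,≤k}` on which the rank is not at most `k - 1`, i.e. on which some
minor of size `k` does not vanish. -/
def symOpen (K : Type u) [Field K] (n : ℕ) (k : ℤ) :
    (Spec (CommRingCat.of (SymLECoord K n k))).Opens :=
  ⟨(PrimeSpectrum.zeroLocus
      (Ideal.map (Ideal.Quotient.mk (minorIdeal K n (k + 1).toNat))
        (minorIdeal K n k.toNat) : Set (SymLECoord K n k)))ᶜ,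
    (PrimeSpectrum.isClosed_zeroLocus _).isOpen_compl⟩

/-- The variety `Sym^{n,k}` of symmetric `n × n` matrices of rank `k` over `K`: the complement of
`Sym^{n,≤k-1}` in `Sym^{n,≤k}`. It is empty unless `0 ≤ k ≤ n`. -/
def symVar (K : Type u) [Field K] (n : ℕ) (k : ℤ) : Var K where
  obj := Over.mk ((symOpen K n k).ι ≫
    Spec.map (CommRingCat.ofHom (algebraMap K (SymLECoord K n k))))
  property := by
    have h1 : LocallyOfFiniteType
        (Spec.map (CommRingCat.ofHom (algebraMap K (SymLECoord K n k)))) := by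
      rw [HasRingHomProperty.Spec_iff (P := @LocallyOfFiniteType)]
      exact RingHom.finiteType_algebraMap.mpr inferInstance
    have h2 : IsNoetherianRing (CommRingCat.of (SymLECoord K n k)) :=
      inferInstanceAs (IsNoetherianRing (SymLECoord K n k))
    dsimp only [isVariety, Over.mk_hom]
    exact ⟨inferInstance, inferInstance, inferInstance⟩

end

open scoped TensorProduct

/-! ### Classes of affine varieties in the Grothendieck ring. -/

noncomputable section

variable {K : Type u} [Field K]

/-! Sort the symmetric matrices of size n = m + 1 by the rank t of the block N left after deleting
the first row and column. For fixed N, the bordering vector consists of a corner and a vector v of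
length m. The rank of the whole matrix is t + 2 if v is outside the column space of N. If v is
inside, the rank is t or t + 1, according to whether the corner takes the one value determined by v.
So rank at most t, t + 1, t + 2 is achieved by a fibre of class 𝕃^t, 𝕃^(t+1), 𝕃^n. Taking
differences, the blocks of rank k, k - 1 and k - 2 contribute the three terms of the formula.

To make this motivic, the locally closed rank loci are replaced by differences of affine closed ones
(`varClass_symVar`), which are cut out by minors. The base is then cut until every minor of N is
zero or invertible (`eq_zero_of_forall_zero_or_isUnit`). On such a piece N has an invertible r × r
block with rows I, columns J and inverse Q, and its Schur complement vanishes: N = N_J Q N_I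
(`Matrix.exists_rank_of_minors`). The condition on v becomes v = N_J Q v_I, so the bordering locus
has the field-valued points of a graph over affine space (`specClass_genericBordered`). As classes
ignore nilpotents, checking points over fields is enough. Additivity reassembles the pieces in
`specClass_genericBordered_eq_sum`. -/

instance Algebra.FiniteType.tensorProduct {R A B : Type*} [CommRing R] [Algebra K R] [CommRing A]
    [Algebra K A] [Algebra R A] [IsScalarTower K R A] [CommRing B] [Algebra K B] [Algebra R B]
    [IsScalarTower K R B] [Algebra.FiniteType K A] [Algebra.FiniteType K B] :
    Algebra.FiniteType K (A ⊗[R] B) :=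
  have : Algebra.FiniteType R B := .of_restrictScalars_finiteType K R B
  .trans (S := A) inferInstance inferInstance

/-- The affine variety `Spec A` of a `K`-algebra of finite type. -/
def specVar (K : Type u) [Field K] (A : Type u) [CommRing A] [Algebra K A]
    [Algebra.FiniteType K A] : Var K where
  obj := Over.mk (Spec.map (CommRingCat.ofHom (algebraMap K A)))
  property := by
    have h1 : LocallyOfFiniteType (Spec.map (CommRingCat.ofHom (algebraMap K A))) := by
      rw [HasRingHomProperty.Spec_iff (P := @LocallyOfFiniteType)]
      exact RingHom.finiteType_algebraMap.mpr inferInstance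
    have h2 : QuasiCompact (Spec.map (CommRingCat.ofHom (algebraMap K A))) := inferInstance
    dsimp only [isVariety, Over.mk_hom]
    exact ⟨inferInstance, h1, h2⟩

/-- The morphism of affine varieties given by a homomorphism of algebras. -/
def specVarMap {A B : Type u} [CommRing A] [Algebra K A] [Algebra.FiniteType K A]
    [CommRing B] [Algebra K B] [Algebra.FiniteType K B] (φ : A →ₐ[K] B) :
    specVar K B ⟶ specVar K A :=
  ObjectProperty.homMk (Over.homMk (Spec.map (CommRingCat.ofHom φ.toRingHom)) (by
    dsimp [specVar]
    rw [← Spec.map_comp, ← CommRingCat.ofHom_comp]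
    congr 2
    exact φ.comp_algebraMap))

lemma specVarMap_id (A : Type u) [CommRing A] [Algebra K A] [Algebra.FiniteType K A] :
    specVarMap (AlgHom.id K A) = 𝟙 (specVar K A) := by
  ext1
  ext1
  exact Spec.map_id _

lemma specVarMap_comp {A B C : Type u} [CommRing A] [Algebra K A] [Algebra.FiniteType K A]
    [CommRing B] [Algebra K B] [Algebra.FiniteType K B]
    [CommRing C] [Algebra K C] [Algebra.FiniteType K C] (φ : A →ₐ[K] B) (ψ : B →ₐ[K] C) :
    specVarMap (ψ.comp φ) = specVarMap ψ ≫ specVarMap φ := by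
  ext1
  ext1
  exact Spec.map_comp (CommRingCat.ofHom φ.toRingHom) (CommRingCat.ofHom ψ.toRingHom)

/-- The class of `Spec A` in the Grothendieck ring. -/
def specClass (K : Type u) [Field K] (A : Type u) [CommRing A] [Algebra K A]
    [Algebra.FiniteType K A] : K0Var K := varClass (specVar K A)

lemma varClass_congr {X Y : Var K} (e : X ≅ Y) : varClass X = varClass Y := by
  rw [varClass, varClass, congr_toSkeleton_of_iso e]

lemma varClass_eq_add {X Z U : Var K} (i : Z ⟶ X) (j : U ⟶ X)
    (hi : IsClosedImmersion i.hom.left) (hj : IsOpenImmersion j.hom.left)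
    (h : Set.range j.hom.left = (Set.range i.hom.left)ᶜ) :
    varClass X = varClass Z + varClass U := by
  have h : FreeAbelianGroup.of (toSkeleton X) - FreeAbelianGroup.of (toSkeleton Z)
      - FreeAbelianGroup.of (toSkeleton U) ∈ Ideal.span (scissorRelations K) :=
    Ideal.subset_span ⟨X, Z, U, i, j, hi, hj, h, rfl⟩
  have h2 := Ideal.Quotient.eq_zero_iff_mem.mpr h
  rw [map_sub, map_sub, sub_sub, sub_eq_zero] at h2
  exact h2

lemma varClass_mul (X Y : Var K) : varClass X * varClass Y = varClass (X ⊗ Y) := by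
  rw [varClass, varClass, varClass, Skeleton.toSkeleton_tensorObj, ← map_mul,
    FreeAbelianGroup.of_mul_of]

section

variable {A B : Type u} [CommRing A] [Algebra K A] [Algebra.FiniteType K A]
  [CommRing B] [Algebra K B] [Algebra.FiniteType K B]

lemma specClass_congr (e : A ≃ₐ[K] B) : specClass K A = specClass K B := by
  refine varClass_congr ⟨specVarMap e.symm.toAlgHom, specVarMap e.toAlgHom, ?_, ?_⟩
  · rw [← specVarMap_comp, e.symm_comp, specVarMap_id]
  · rw [← specVarMap_comp, e.comp_symm, specVarMap_id]

lemma specClass_mul : specClass K A * specClass K B = specClass K (A ⊗[K] B) := by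
  rw [specClass, specClass, varClass_mul]
  refine varClass_congr (ObjectProperty.isoMk _ (Over.isoMk (f := (specVar K A ⊗ specVar K B).obj)
    (g := (specVar K (A ⊗[K] B)).obj) (pullbackSpecIso K A B) ?_))
  change (pullbackSpecIso K A B).hom ≫ Spec.map (CommRingCat.ofHom (algebraMap K (A ⊗[K] B))) =
    Limits.pullback.fst _ _ ≫ Spec.map (CommRingCat.ofHom (algebraMap K A))
  exact pullbackSpecIso_hom_base K A B

lemma lefschetz_eq_specClass : lefschetz K = specClass K (MvPolynomial PUnit.{u + 1} K) := by
  refine varClass_congr (ObjectProperty.isoMk _ (Over.isoMk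
    (AffineSpace.SpecIso PUnit (CommRingCat.of K)) ?_))
  have := AffineSpace.SpecIso_inv_over (n := PUnit.{u + 1}) (CommRingCat.of K)
  rw [Iso.inv_comp_eq] at this
  exact this.symm

/-- Cutting `Spec A` along a closed subset with given open complement. -/
lemma specClass_eq_add_varClass (φ : A →ₐ[K] B) (hφ : Function.Surjective φ) (U : Var K)
    (j : U ⟶ specVar K A) (hj : IsOpenImmersion j.hom.left)
    (h : Set.range j.hom.left = (PrimeSpectrum.zeroLocus (RingHom.ker φ : Set A))ᶜ) :
    specClass K A = specClass K B + varClass U := by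
  refine varClass_eq_add (specVarMap φ) j ?_ hj ?_
  · exact IsClosedImmersion.spec_of_surjective _ hφ
  · rw [h]
    congr 1
    exact (range_comap_of_surjective _ φ.toRingHom hφ).symm

end

section

variable {A : Type u} [CommRing A] [Algebra K A] [Algebra.FiniteType K A]
  {B : Type u} [CommRing B] [Algebra K B] [Algebra.FiniteType K B]

/-- The empty scheme is the complement of itself in itself, so its class equals twice its class. -/
lemma specClass_of_subsingleton [Subsingleton A] : specClass K A = 0 := by
  have h := specClass_eq_add_varClass (AlgHom.id K A) Function.surjective_id (specVar K A)
    (𝟙 _) (inferInstanceAs (IsOpenImmersion (𝟙 _))) (Set.ext fun p => isEmptyElim (α := PrimeSpectrum A) p)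
  change specClass K A = specClass K A + specClass K A at h
  simpa using h

/-- The scissor relation of a hypersurface and its complement. -/
lemma specClass_eq_quotient_add_away (f : A) (C : Type u) [CommRing C] [Algebra K C]
    [Algebra.FiniteType K C] [Algebra A C] [IsScalarTower K A C] [IsLocalization.Away f C] :
    specClass K A = specClass K (A ⧸ Ideal.span {f}) + specClass K C := by
  refine specClass_eq_add_varClass (Ideal.Quotient.mkₐ K (Ideal.span {f}))
    (Ideal.Quotient.mkₐ_surjective _ _) (specVar K C) (specVarMap (IsScalarTower.toAlgHom K A C))
    (IsOpenImmersion.of_isLocalization f) ?_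
  have hker : RingHom.ker (Ideal.Quotient.mkₐ K (Ideal.span {f})) = Ideal.span {f} :=
    Ideal.mk_ker
  rw [hker, PrimeSpectrum.zeroLocus_span]
  exact (PrimeSpectrum.localization_away_comap_range C f).trans
    (PrimeSpectrum.basicOpen_eq_zeroLocus_compl f)

/-- The class of an affine variety does not see nilpotent functions. -/
lemma specClass_eq_of_surjective (φ : A →ₐ[K] B) (hφ : Function.Surjective φ)
    (h : ∀ a, φ a = 0 → IsNilpotent a) : specClass K A = specClass K B := by
  let f : A →ₐ[K] PUnit.{u + 1} := ⟨⟨⟨⟨fun _ => PUnit.unit, rfl⟩, fun _ _ => rfl⟩, rfl,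
    fun _ _ => rfl⟩, fun _ => rfl⟩
  have : Algebra.FiniteType K PUnit.{u + 1} := .of_surjective f fun _ => ⟨0, rfl⟩
  have hempty : IsEmpty (PrimeSpectrum PUnit.{u + 1}) := inferInstance
  have e : specClass K A = specClass K B + specClass K PUnit.{u + 1} := by
    refine specClass_eq_add_varClass φ hφ _ (specVarMap f)
      (isOpenImmersion_of_isEmpty (X := Spec (CommRingCat.of PUnit.{u + 1})) _) ?_
    have hle : (RingHom.ker φ : Set A) ⊆ nilradical A := fun a ha => h a ha
    rw [(PrimeSpectrum.zeroLocus_eq_univ_iff _).mpr hle]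
    exact (Set.range_eq_empty_iff.mpr hempty).trans Set.compl_univ.symm
  rw [e, specClass_of_subsingleton (A := PUnit.{u + 1}), add_zero]

/-- Two closed subschemes with the same points over fields have the same class. -/
lemma specClass_quotient_congr {I J : Ideal A}
    (h : ∀ (L : Type u) [Field L] (x : A →+* L), (∀ a ∈ I, x a = 0) ↔ ∀ a ∈ J, x a = 0) :
    specClass K (A ⧸ I) = specClass K (A ⧸ J) := by
  have hrad : I.radical = J.radical := by
    rw [← PrimeSpectrum.zeroLocus_eq_iff]
    ext p
    -- The kernel of the map to the residue field at `p` is `p`, so these test points detect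
    -- membership in the zero locus.
    have := h p.asIdeal.ResidueField (algebraMap A _)
    simpa [PrimeSpectrum.mem_zeroLocus, Set.subset_def,
      Ideal.algebraMap_residueField_eq_zero] using this
  have key (I : Ideal A) : specClass K (A ⧸ I) = specClass K (A ⧸ I.radical) := by
    refine specClass_eq_of_surjective (Ideal.Quotient.factorₐ K I.le_radical)
      (Ideal.Quotient.factor_surjective I.le_radical) fun a ha => ?_
    obtain ⟨a, rfl⟩ := Ideal.Quotient.mk_surjective a
    change Ideal.Quotient.mk _ a = 0 at ha
    rw [Ideal.Quotient.eq_zero_iff_mem] at ha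
    obtain ⟨n, hn⟩ := ha
    exact ⟨n, by rwa [← map_pow, Ideal.Quotient.eq_zero_iff_mem]⟩
  rw [key I, key J, hrad]

instance Algebra.FiniteType.mvPolynomial_of_finiteType {σ : Type*} [Finite σ] :
    Algebra.FiniteType K (MvPolynomial σ A) :=
  .trans (S := A) inferInstance inferInstance

lemma specClass_mvPolynomial (n : ℕ) :
    specClass K (MvPolynomial (Fin n) A) = lefschetz K ^ n * specClass K A := by
  have key (A : Type u) [CommRing A] [Algebra K A] [Algebra.FiniteType K A] :
      specClass K (MvPolynomial PUnit.{u + 1} A) = lefschetz K * specClass K A := by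
    rw [lefschetz_eq_specClass, mul_comm, specClass_mul]
    exact (specClass_congr
      ((MvPolynomial.algebraTensorAlgEquiv (σ := PUnit.{u + 1}) K A).restrictScalars K)).symm
  induction n with
  | zero =>
    rw [pow_zero, one_mul]
    exact specClass_congr ((MvPolynomial.isEmptyAlgEquiv A (Fin 0)).restrictScalars K)
  | succ n ih =>
    rw [pow_succ', mul_assoc, ← ih, ← key]
    let e : Fin (n + 1) ≃ PUnit.{u + 1} ⊕ Fin n :=
      ((finSuccEquiv n).trans (Equiv.optionEquivSumPUnit _)).trans (Equiv.sumComm _ _)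
    exact specClass_congr (((MvPolynomial.renameEquiv A e).trans
      (MvPolynomial.sumAlgEquiv A PUnit.{u + 1} (Fin n))).restrictScalars K)

end

/-! ### Ideals of minors and the closed rank loci. -/

/-- The ideal generated by the `s × s` minors of a matrix. -/
def Matrix.minorIdeal {ι R : Type*} [CommRing R] (M : Matrix ι ι R) (s : ℕ) : Ideal R :=
  Ideal.span (Set.range fun rc : (Fin s → ι) × (Fin s → ι) => (M.submatrix rc.1 rc.2).det)

namespace Matrix

variable {ι R : Type*} [CommRing R] (M : Matrix ι ι R)

lemma det_submatrix_mem_minorIdeal {s : ℕ} (f g : Fin s → ι) :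
    (M.submatrix f g).det ∈ M.minorIdeal s :=
  Ideal.subset_span ⟨(f, g), rfl⟩

lemma minorIdeal_le_iff {s : ℕ} {I : Ideal R} :
    M.minorIdeal s ≤ I ↔ ∀ f g : Fin s → ι, (M.submatrix f g).det ∈ I := by
  rw [minorIdeal, Ideal.span_le, Set.range_subset_iff, Prod.forall]
  rfl

lemma minorIdeal_antitone : Antitone M.minorIdeal := by
  refine antitone_nat_of_succ_le fun s => ?_
  rw [minorIdeal_le_iff]
  intro f g
  rw [det_succ_row_zero]
  refine Ideal.sum_mem _ fun j _ => Ideal.mul_mem_left _ _ ?_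
  rw [submatrix_submatrix]
  exact M.det_submatrix_mem_minorIdeal _ _

lemma map_minorIdeal {S : Type*} [CommRing S] (φ : R →+* S) (s : ℕ) :
    (M.minorIdeal s).map φ = (M.map φ).minorIdeal s := by
  rw [minorIdeal, minorIdeal, Ideal.map_span, ← Set.range_comp]
  congr 2
  ext rc
  exact φ.map_det _

lemma minorIdeal_eq_bot_of_card_lt [Fintype ι] {s : ℕ} (h : Fintype.card ι < s) :
    M.minorIdeal s = ⊥ := by
  rw [← le_bot_iff, minorIdeal_le_iff]
  intro f g
  obtain ⟨i, j, hij, hf⟩ := Fintype.exists_ne_map_eq_of_card_lt f (by simpa using h)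
  exact det_zero_of_row_eq hij (funext fun k => by simp [hf])

end Matrix

/-- The class of the locus of symmetric matrices all of whose `s × s` minors vanish. -/
def symClass (K : Type u) [Field K] (n s : ℕ) : K0Var K :=
  specClass K (SymCoord K n ⧸ (genericSym K n).minorIdeal s)

/-- From here on only coordinate rings matter. For `k < 0` both truncated indices are `0` and the
difference vanishes, as it should for an empty variety. -/
lemma varClass_symVar (n : ℕ) (k : ℤ) :
    varClass (symVar K n k) = symClass K n (k + 1).toNat - symClass K n k.toNat := by
  have hle : minorIdeal K n (k + 1).toNat ≤ minorIdeal K n k.toNat :=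
    (genericSym K n).minorIdeal_antitone (by omega)
  let φ : SymLECoord K n k →ₐ[K] SymCoord K n ⧸ minorIdeal K n k.toNat :=
    Ideal.Quotient.factorₐ K hle
  let j : symVar K n k ⟶ specVar K (SymLECoord K n k) :=
    ObjectProperty.homMk (Over.homMk (symOpen K n k).ι rfl)
  have h := specClass_eq_add_varClass φ (Ideal.Quotient.factor_surjective hle) (symVar K n k) j
    (inferInstanceAs (IsOpenImmersion (symOpen K n k).ι)) ?_
  · rw [eq_sub_iff_add_eq, add_comm]
    exact h.symm
  · refine (symOpen K n k).range_ι.trans ?_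
    have : RingHom.ker φ = Ideal.map (Ideal.Quotient.mk (minorIdeal K n (k + 1).toNat))
        (minorIdeal K n k.toNat) := Ideal.Quotient.factor_ker hle
    rw [this]
    rfl

/-! ### Schur complements and the rank of a bordered matrix. -/

namespace Matrix

/-- The symmetric matrix obtained from `N` by adding the vector `u` as first row and column. -/
def bordered {R : Type*} {m : ℕ} (N : Matrix (Fin m) (Fin m) R) (u : Fin (m + 1) → R) :
    Matrix (Fin (m + 1)) (Fin (m + 1)) R :=
  of fun i j => Fin.cases (u j) (fun i' => Fin.cases (u i'.succ) (fun j' => N i' j') j) i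

section

variable {R : Type*} {m : ℕ} (N : Matrix (Fin m) (Fin m) R) (u : Fin (m + 1) → R)

@[simp] lemma bordered_zero_left (j : Fin (m + 1)) : bordered N u 0 j = u j := rfl

@[simp] lemma bordered_succ_zero (i : Fin m) : bordered N u i.succ 0 = u i.succ := rfl

@[simp] lemma bordered_succ_succ (i j : Fin m) : bordered N u i.succ j.succ = N i j := rfl

lemma bordered_map {S : Type*} (φ : R → S) :
    (bordered N u).map φ = bordered (N.map φ) (φ ∘ u) := by
  ext i j
  cases i using Fin.cases <;> cases j using Fin.cases <;> rfl

end

section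

variable {R ι τ : Type*} [CommRing R] [Fintype τ] [DecidableEq τ]

/-- The generalised Schur complement of the block of `M` with rows `I` and columns `J`,
for a matrix `Q` inverse to this block. -/
def schur (M : Matrix ι ι R) (I J : τ → ι) (Q : Matrix τ τ R) : Matrix ι ι R :=
  M - M.submatrix id J * Q * M.submatrix I id

variable (M : Matrix ι ι R) {I J : τ → ι} {Q : Matrix τ τ R}

lemma det_submatrix_sumElim (hQ : M.submatrix I J * Q = 1) {s : Type*} [Fintype s] [DecidableEq s]
    (f g : s → ι) :
    (M.submatrix (Sum.elim I f) (Sum.elim J g)).det =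
      (M.submatrix I J).det * ((M.schur I J Q).submatrix f g).det := by
  let : Invertible (M.submatrix I J) := ⟨Q, mul_eq_one_comm.mp hQ, hQ⟩
  have h := det_fromBlocks₁₁ (M.submatrix I J) (M.submatrix I g) (M.submatrix f J)
    (M.submatrix f g)
  have e : M.submatrix (Sum.elim I f) (Sum.elim J g) = fromBlocks (M.submatrix I J)
      (M.submatrix I g) (M.submatrix f J) (M.submatrix f g) := by
    ext (i | i) (j | j) <;> rfl
  rw [e, h]
  rfl

lemma det_submatrix_mem_minorIdeal_of_card {s : Type*} [Fintype s] [DecidableEq s] (f g : s → ι)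
    {n : ℕ} (hn : Fintype.card s = n) : (M.submatrix f g).det ∈ M.minorIdeal n := by
  have e : Fin n ≃ s := (Fintype.equivFinOfCardEq hn).symm
  rw [← det_submatrix_equiv_self e]
  exact M.det_submatrix_mem_minorIdeal (f ∘ e) (g ∘ e)

/-- If the block `I × J` is invertible, the minors of the Schur complement vanish together with
the larger minors of the matrix. -/
lemma det_schur_submatrix_eq_zero (hQ : M.submatrix I J * Q = 1) {n : ℕ}
    (h : M.minorIdeal (Fintype.card τ + n) = ⊥) (f g : Fin n → ι) :
    ((M.schur I J Q).submatrix f g).det = 0 := by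
  have h1 := M.det_submatrix_mem_minorIdeal_of_card (Sum.elim I f) (Sum.elim J g)
    (n := Fintype.card τ + n) (by simp)
  rw [h, Ideal.mem_bot, det_submatrix_sumElim M hQ] at h1
  have hu : IsUnit (M.submatrix I J).det := by
    rw [← isUnit_iff_isUnit_det]
    exact IsUnit.of_mul_eq_one _ hQ
  exact hu.mul_right_eq_zero.mp h1

lemma schur_eq_zero (hQ : M.submatrix I J * Q = 1) (h : M.minorIdeal (Fintype.card τ + 1) = ⊥) :
    M.schur I J Q = 0 := by
  ext i j
  simpa using det_schur_submatrix_eq_zero M hQ h (fun _ => i) (fun _ => j)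

end

section

variable {L ι : Type*} [Field L] [Fintype ι]

lemma rank_add_le_add {m : Type*} (M N : Matrix m ι L) : (M + N).rank ≤ M.rank + N.rank := by
  rw [rank, rank, rank, mulVecLin_add]
  refine (Submodule.finrank_mono (LinearMap.range_add_le _ _)).trans ?_
  exact Submodule.finrank_add_le_finrank_add_finrank _ _

lemma minorIdeal_eq_bot_of_rank_lt (M : Matrix ι ι L) {s : ℕ} (h : M.rank < s) :
    M.minorIdeal s = ⊥ := by
  rw [← le_bot_iff, minorIdeal_le_iff]
  intro f g
  by_contra hne
  have h1 : (M.submatrix f g).rank = s := by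
    rw [rank_of_isUnit _ ((isUnit_iff_isUnit_det _).mpr (Ne.isUnit hne)), Fintype.card_fin]
  exact absurd (M.rank_submatrix_le f g) (by omega)

/-- The part of `M` removed by the Schur complement factors through a space of dimension
`Fintype.card τ`. -/
lemma rank_le_add_rank_schur {τ : Type*} [Fintype τ] [DecidableEq τ] (M : Matrix ι ι L)
    (I J : τ → ι) (Q : Matrix τ τ L) : M.rank ≤ Fintype.card τ + (M.schur I J Q).rank := by
  have h : M = M.submatrix id J * Q * M.submatrix I id + M.schur I J Q := by
    rw [schur, add_sub_cancel]
  conv_lhs => rw [h]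
  refine (rank_add_le_add _ _).trans (Nat.add_le_add_right ?_ _)
  exact (rank_mul_le_right _ _).trans (rank_le_card_height _)

end

section Bordered

variable {R : Type*} [CommRing R] {m r : ℕ} {N : Matrix (Fin m) (Fin m) R} {I J : Fin r → Fin m}
  {Q : Matrix (Fin r) (Fin r) R}

/-- The deviation of the first column of a bordered matrix from the column space of `N`. -/
def columnDefect (N : Matrix (Fin m) (Fin m) R) (I J : Fin r → Fin m)
    (Q : Matrix (Fin r) (Fin r) R) (u : Fin (m + 1) → R) (i : Fin m) : R :=
  u i.succ - ∑ p, ∑ q, N i (J p) * Q p q * u (I q).succ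

/-- The deviation of the corner of a bordered matrix from the value that keeps the rank. -/
def cornerDefect (I J : Fin r → Fin m) (Q : Matrix (Fin r) (Fin r) R) (u : Fin (m + 1) → R) : R :=
  u 0 - ∑ p, ∑ q, u (J p).succ * Q p q * u (I q).succ

lemma schur_apply {ι τ : Type*} [Fintype τ] (M : Matrix ι ι R) (I J : τ → ι) (Q : Matrix τ τ R)
    (i j : ι) : M.schur I J Q i j = M i j - ∑ p, ∑ q, M i (J p) * Q p q * M (I q) j := by
  rw [schur, sub_apply, mul_apply]
  simp only [mul_apply, submatrix_apply, id_eq, Finset.sum_mul]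
  rw [Finset.sum_comm]

variable (u : Fin (m + 1) → R)

lemma schur_bordered_succ_zero (i : Fin m) :
    (bordered N u).schur (Fin.succ ∘ I) (Fin.succ ∘ J) Q i.succ 0 = columnDefect N I J Q u i := by
  simp [schur_apply, columnDefect]

lemma schur_bordered_zero_zero :
    (bordered N u).schur (Fin.succ ∘ I) (Fin.succ ∘ J) Q 0 0 = cornerDefect I J Q u := by
  simp [schur_apply, cornerDefect]

lemma schur_bordered_zero_succ (j : Fin m) :
    (bordered N u).schur (Fin.succ ∘ I) (Fin.succ ∘ J) Q 0 j.succ =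
      u j.succ - ∑ p, ∑ q, u (J p).succ * Q p q * N (I q) j := by
  simp [schur_apply]

lemma schur_bordered_succ_succ (hN : N.schur I J Q = 0) (i j : Fin m) :
    (bordered N u).schur (Fin.succ ∘ I) (Fin.succ ∘ J) Q i.succ j.succ = 0 := by
  have := congr_fun₂ hN i j
  rw [schur_apply] at this ⊢
  simpa using this

lemma eq_of_schur_eq_zero (hN : N.schur I J Q = 0) (i j : Fin m) :
    ∑ p, ∑ q, N i (J p) * Q p q * N (I q) j = N i j := by
  have := congr_fun₂ hN i j
  rw [schur_apply, zero_apply, sub_eq_zero] at this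
  exact this.symm

/-- By hypothesis the tail of `u` is a combination of the rows `I` of `N`, hence by symmetry of its
columns `I`. The factorisation N = N_J Q N_I reproduces every column of `N`, so it reproduces this
combination. The block `I × J` need not be principal, which is why rows and columns have to be
exchanged. -/
lemma columnDefect_eq_zero_of_row (hS : N.IsSymm) (hN : N.schur I J Q = 0)
    (h : ∀ j : Fin m, u j.succ = ∑ p, ∑ q, u (J p).succ * Q p q * N (I q) j) :
    columnDefect N I J Q u = 0 := by
  have h' (j : Fin m) : u j.succ = ∑ t, (∑ p, u (J p).succ * Q p t) * N j (I t) := by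
    rw [h, Finset.sum_comm]
    simp only [Finset.sum_mul, hS.apply]
  ext i
  rw [columnDefect, Pi.zero_apply, sub_eq_zero]
  calc u i.succ = ∑ t, (∑ p, u (J p).succ * Q p t) * N i (I t) := h' i
    _ = ∑ t, ∑ p, ∑ q, N i (J p) * Q p q * ((∑ p, u (J p).succ * Q p t) * N (I q) (I t)) := by
      refine Finset.sum_congr rfl fun t _ => ?_
      rw [← eq_of_schur_eq_zero hN i (I t), Finset.mul_sum]
      refine Finset.sum_congr rfl fun p _ => ?_
      rw [Finset.mul_sum]
      exact Finset.sum_congr rfl fun q _ => by ring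
    _ = ∑ p, ∑ q, N i (J p) * Q p q * u (I q).succ := by
      rw [Finset.sum_comm]
      refine Finset.sum_congr rfl fun p _ => ?_
      rw [Finset.sum_comm]
      refine Finset.sum_congr rfl fun q _ => ?_
      rw [h' (I q), Finset.mul_sum]

/-- The converse passage from column to row: the tail of `u` is a combination of the columns `J`, by
symmetry of the rows `J`, and N = N_J Q N_I reproduces rows as well. -/
lemma schur_bordered_zero_succ_eq_zero (hS : N.IsSymm) (hN : N.schur I J Q = 0)
    (h : columnDefect N I J Q u = 0) (j : Fin m) :
    (bordered N u).schur (Fin.succ ∘ I) (Fin.succ ∘ J) Q 0 j.succ = 0 := by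
  have hu (i : Fin m) : u i.succ = ∑ t, N i (J t) * ∑ q, Q t q * u (I q).succ := by
    have := congr_fun h i
    rw [columnDefect, Pi.zero_apply, sub_eq_zero] at this
    simpa only [Finset.mul_sum, mul_assoc] using this
  rw [schur_bordered_zero_succ, sub_eq_zero]
  calc u j.succ = ∑ t, N j (J t) * ∑ q, Q t q * u (I q).succ := hu j
    _ = ∑ t, ∑ p, ∑ q, N (J p) (J t) * (∑ q, Q t q * u (I q).succ) * Q p q * N (I q) j := by
      refine Finset.sum_congr rfl fun t _ => ?_
      rw [← hS.apply, ← eq_of_schur_eq_zero hN (J t) j, Finset.sum_mul]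
      refine Finset.sum_congr rfl fun p _ => ?_
      rw [Finset.sum_mul]
      refine Finset.sum_congr rfl fun q _ => ?_
      rw [hS.apply (J t) (J p)]
      ring
    _ = ∑ p, ∑ q, u (J p).succ * Q p q * N (I q) j := by
      rw [Finset.sum_comm]
      refine Finset.sum_congr rfl fun p _ => ?_
      rw [Finset.sum_comm]
      refine Finset.sum_congr rfl fun q _ => ?_
      rw [hu (J p), Finset.sum_mul, Finset.sum_mul]

lemma minorIdeal_bordered_eq_top (hQ : N.submatrix I J * Q = 1) {s : ℕ} (hs : s ≤ r) :
    (bordered N u).minorIdeal s = ⊤ := by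
  rw [← top_le_iff]
  refine le_trans ?_ ((bordered N u).minorIdeal_antitone hs)
  rw [top_le_iff]
  have h := (bordered N u).det_submatrix_mem_minorIdeal (Fin.succ ∘ I) (Fin.succ ∘ J)
  refine Ideal.eq_top_of_isUnit_mem _ h ?_
  rw [← isUnit_iff_isUnit_det]
  exact IsUnit.of_mul_eq_one Q hQ

end Bordered

section BorderedField

variable {L : Type*} [Field L] {m r : ℕ} {N : Matrix (Fin m) (Fin m) L} {I J : Fin r → Fin m}
  {Q : Matrix (Fin r) (Fin r) L} (u : Fin (m + 1) → L)

lemma rank_schur_bordered_le (hN : N.schur I J Q = 0) :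
    ((bordered N u).schur (Fin.succ ∘ I) (Fin.succ ∘ J) Q).rank ≤ 2 := by
  set T := (bordered N u).schur (Fin.succ ∘ I) (Fin.succ ∘ J) Q
  -- Only the first row and the first column of `T` survive, and each is a matrix of rank at most
  -- one; the corner is counted with the column.
  have h : T = vecMulVec (fun i => T i 0) (Pi.single 0 1) +
      vecMulVec (Pi.single 0 1) (fun j => if j = 0 then 0 else T 0 j) := by
    ext i j
    cases i using Fin.cases <;> cases j using Fin.cases <;>
      simp [vecMulVec_apply, T, schur_bordered_succ_succ u hN]
  rw [h]
  exact (rank_add_le_add _ _).trans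
    (add_le_add (rank_vecMulVec_le _ _) (rank_vecMulVec_le _ _))

lemma minorIdeal_bordered_of_lt (hN : N.schur I J Q = 0) {s : ℕ} (hs : r + 2 < s) :
    (bordered N u).minorIdeal s = ⊥ := by
  apply minorIdeal_eq_bot_of_rank_lt
  have h1 := (bordered N u).rank_le_add_rank_schur (Fin.succ ∘ I) (Fin.succ ∘ J) Q
  have h2 := rank_schur_bordered_le u hN
  rw [Fintype.card_fin] at h1
  omega

lemma minorIdeal_bordered_eq_bot_iff (hS : N.IsSymm) (hQ : N.submatrix I J * Q = 1)
    (hN : N.schur I J Q = 0) :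
    (bordered N u).minorIdeal (r + 2) = ⊥ ↔ ∀ i, columnDefect N I J Q u i = 0 := by
  set T := (bordered N u).schur (Fin.succ ∘ I) (Fin.succ ∘ J) Q
  constructor
  · intro h
    -- The 2 × 2 minor of `T` on rows `0, i + 1` and columns `0, j + 1` is minus the product of a
    -- row entry and a column defect. A nonzero defect thus kills the whole row, and by symmetry
    -- this forces all defects to vanish.
    by_contra! ⟨i, hi⟩
    refine hi (congr_fun (columnDefect_eq_zero_of_row u hS hN fun j => ?_) i)
    have h1 := det_schur_submatrix_eq_zero (bordered N u) (I := Fin.succ ∘ I) (J := Fin.succ ∘ J)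
      (Q := Q) (n := 2) hQ (by rwa [Fintype.card_fin]) ![0, i.succ] ![0, j.succ]
    rw [det_fin_two] at h1
    simp only [submatrix_apply, cons_val_zero, cons_val_one, schur_bordered_succ_succ u hN,
      schur_bordered_succ_zero, schur_bordered_zero_succ, mul_zero, zero_sub, neg_eq_zero,
      mul_eq_zero, hi, or_false, sub_eq_zero] at h1
    exact h1
  · intro h
    apply minorIdeal_eq_bot_of_rank_lt
    have h1 := (bordered N u).rank_le_add_rank_schur (Fin.succ ∘ I) (Fin.succ ∘ J) Q
    have h2 : T = vecMulVec (Pi.single 0 (T 0 0)) (Pi.single 0 1) := by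
      ext i j
      cases i using Fin.cases <;> cases j using Fin.cases <;>
        simp [vecMulVec_apply, T, schur_bordered_succ_succ u hN, schur_bordered_succ_zero, h,
          schur_bordered_zero_succ_eq_zero u hS hN (funext h)]
    have h3 : T.rank ≤ 1 := by
      rw [h2]
      exact rank_vecMulVec_le _ _
    rw [Fintype.card_fin] at h1
    change _ ≤ _ + T.rank at h1
    omega

lemma minorIdeal_bordered_eq_bot_iff' (hS : N.IsSymm) (hQ : N.submatrix I J * Q = 1)
    (hN : N.schur I J Q = 0) :
    (bordered N u).minorIdeal (r + 1) = ⊥ ↔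
      (∀ i, columnDefect N I J Q u i = 0) ∧ cornerDefect I J Q u = 0 := by
  set T := (bordered N u).schur (Fin.succ ∘ I) (Fin.succ ∘ J) Q
  constructor
  · intro h
    have h1 : T = 0 := schur_eq_zero _ hQ (by rwa [Fintype.card_fin])
    refine ⟨fun i => ?_, ?_⟩
    · rw [← schur_bordered_succ_zero]
      exact congr_fun₂ h1 _ _
    · rw [← schur_bordered_zero_zero (N := N)]
      exact congr_fun₂ h1 _ _
  · rintro ⟨h, h'⟩
    apply minorIdeal_eq_bot_of_rank_lt
    have h1 := (bordered N u).rank_le_add_rank_schur (Fin.succ ∘ I) (Fin.succ ∘ J) Q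
    have h2 : T = 0 := by
      ext i j
      cases i using Fin.cases <;> cases j using Fin.cases <;>
        simp [T, schur_bordered_succ_succ u hN, schur_bordered_succ_zero, h,
          schur_bordered_zero_zero, h', schur_bordered_zero_succ_eq_zero u hS hN (funext h)]
    have h3 : T.rank = 0 := by rw [h2, rank_zero]
    rw [Fintype.card_fin] at h1
    change _ ≤ _ + T.rank at h1
    omega

end BorderedField

end Matrix

/-! ### Cutting the base into pieces, and base change. -/

instance Algebra.FiniteType.localizationAway {A : Type*} [CommRing A] [Algebra K A]
    [Algebra.FiniteType K A] (f : A) : Algebra.FiniteType K (Localization.Away f) :=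
  have : Algebra.FiniteType A (Localization.Away f) :=
    IsLocalization.finiteType_of_monoid_fg (Submonoid.powers f) _
  .trans (S := A) inferInstance inferInstance

section

variable {R : Type u} [CommRing R] [Algebra K R]

/-- An additive invariant of algebras over `R` vanishes if it vanishes on those in which each
element of a finite subset of `R` becomes zero or invertible. -/
lemma eq_zero_of_forall_zero_or_isUnit {G : Type*} [AddCommGroup G]
    (Φ : ∀ (A : Type u) [CommRing A] [Algebra K A] [Algebra R A] [IsScalarTower K R A]
      [Algebra.FiniteType K A], G)
    (hΦ : ∀ (A : Type u) [CommRing A] [Algebra K A] [Algebra R A] [IsScalarTower K R A]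
      [Algebra.FiniteType K A] (f : A), Φ A = Φ (A ⧸ Ideal.span {f}) + Φ (Localization.Away f))
    {S : Set R} (hS : S.Finite)
    (h : ∀ (A : Type u) [CommRing A] [Algebra K A] [Algebra R A] [IsScalarTower K R A]
      [Algebra.FiniteType K A], (∀ s ∈ S, algebraMap R A s = 0 ∨ IsUnit (algebraMap R A s)) →
        Φ A = 0)
    (A : Type u) [CommRing A] [Algebra K A] [Algebra R A] [IsScalarTower K R A]
    [Algebra.FiniteType K A] : Φ A = 0 := by
  induction S, hS using Set.Finite.induction_on generalizing A with
  | empty => exact h A (by simp)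
  | @insert a S _ _ ih =>
    refine ih (fun A _ _ _ _ _ hA => ?_) A
    -- The induction hypothesis lets the elements of `S` be settled already. Cutting `A` along `a`
    -- settles `a` too: it is zero on the closed piece and invertible on the open one.
    rw [hΦ A (algebraMap R A a), h, h, add_zero]
    · rintro s (rfl | hs)
      · right
        rw [IsScalarTower.algebraMap_apply R A (Localization.Away _)]
        exact IsLocalization.Away.algebraMap_isUnit (algebraMap R A s)
      · rw [IsScalarTower.algebraMap_apply R A (Localization.Away _)]
        refine (hA s hs).imp (fun h => ?_) (fun h => h.map _)
        rw [h, map_zero]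
    · rintro s (rfl | hs)
      · left
        rw [IsScalarTower.algebraMap_apply R A (A ⧸ _)]
        exact Ideal.Quotient.eq_zero_iff_mem.mpr (Ideal.mem_span_singleton_self _)
      · rw [IsScalarTower.algebraMap_apply R A (A ⧸ _)]
        refine (hA s hs).imp (fun h => ?_) (fun h => h.map _)
        rw [h, map_zero]

variable {A : Type u} [CommRing A] [Algebra K A] [Algebra R A] [IsScalarTower K R A]
  [Algebra.FiniteType K A] {B : Type u} [CommRing B] [Algebra K B] [Algebra R B]
  [IsScalarTower K R B] [Algebra.FiniteType K B]

lemma specClass_baseChange (C : Type u) [CommRing C] [Algebra K C] [Algebra R C]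
    [IsScalarTower K R C] [Algebra A C] [IsScalarTower R A C] [IsScalarTower K A C]
    [Algebra.FiniteType K C] :
    specClass K ((A ⊗[R] B) ⊗[A] C) = specClass K (C ⊗[R] B) :=
  (specClass_congr ((Algebra.TensorProduct.comm A (A ⊗[R] B) C).restrictScalars K)).trans
    (specClass_congr ((Algebra.TensorProduct.cancelBaseChange R A A C B).restrictScalars K))

/-- This is the additivity that `eq_zero_of_forall_zero_or_isUnit` requires, for the invariant
sending `A` to the class of `A ⊗[R] B`. -/
lemma specClass_tensorProduct_eq_add (f : A) :
    specClass K (A ⊗[R] B) =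
      specClass K ((A ⧸ Ideal.span {f}) ⊗[R] B) + specClass K (Localization.Away f ⊗[R] B) := by
  rw [specClass_eq_quotient_add_away (algebraMap A (A ⊗[R] B) f)
    ((A ⊗[R] B) ⊗[A] Localization.Away f), specClass_baseChange,
    ← specClass_baseChange (R := R) (A := A) (B := B) (A ⧸ Ideal.span {f})]
  congr 1
  have h := (Algebra.TensorProduct.quotIdealMapEquivTensorQuot (A ⊗[R] B) (Ideal.span {f}))
  rw [Ideal.map_span, Set.image_singleton] at h
  exact specClass_congr (h.restrictScalars K)

/-- Base change of a closed subscheme of an affine space. -/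
lemma specClass_tensorProduct_quotient {σ : Type} [Finite σ] [Algebra.FiniteType K R]
    (I : Ideal (MvPolynomial σ R)) :
    specClass K (A ⊗[R] (MvPolynomial σ R ⧸ I)) =
      specClass K (MvPolynomial σ A ⧸ I.map (MvPolynomial.map (algebraMap R A))) := by
  refine specClass_congr (((Algebra.TensorProduct.tensorQuotientEquiv A (MvPolynomial σ R) A
    I).trans (Ideal.quotientEquivAlg _ _
      (MvPolynomial.algebraTensorAlgEquiv R A) ?_)).restrictScalars K)
  change _ = Ideal.map (MvPolynomial.algebraTensorAlgEquiv R A).toRingHom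
    (Ideal.map Algebra.TensorProduct.includeRight.toRingHom I)
  rw [Ideal.map_map]
  congr 1
  ext
  · simp
  · simp

end

/-! ### Bordering loci over a base on which the rank is constant. -/

section

variable {A : Type u} [CommRing A] [Algebra K A] [Algebra.FiniteType K A]

/-- A closed subscheme of an affine space that is the graph of a polynomial map. -/
lemma specClass_quotient_eq_of_section {σ τ : Type} [Finite σ] [Finite τ]
    (I : Ideal (MvPolynomial σ A)) (φ : MvPolynomial σ A →ₐ[A] MvPolynomial τ A)
    (ψ : MvPolynomial τ A →ₐ[A] MvPolynomial σ A) (h : ∀ i, φ (ψ (.X i)) = .X i)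
    (hφ : ∀ a ∈ I, φ a = 0) (hψ : ∀ i, .X i - ψ (φ (.X i)) ∈ I) :
    specClass K (MvPolynomial σ A ⧸ I) = specClass K (MvPolynomial τ A) := by
  refine specClass_congr ((AlgEquiv.ofAlgHom (Ideal.Quotient.liftₐ I φ hφ)
    ((Ideal.Quotient.mkₐ A I).comp ψ) ?_ ?_).restrictScalars K)
  · refine MvPolynomial.algHom_ext fun i => ?_
    exact h i
  · refine Ideal.Quotient.algHom_ext _ (MvPolynomial.algHom_ext fun i => ?_)
    exact (Ideal.Quotient.eq.mpr (hψ i)).symm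

namespace Matrix

/-- The vector `N_J Q y`, which spans the column space of `N` as `y` varies. -/
def columnForm {R : Type*} [CommRing R] {m r : ℕ} (N : Matrix (Fin m) (Fin m) R)
    (J : Fin r → Fin m) (Q : Matrix (Fin r) (Fin r) R) (y : Fin r → R) (i : Fin m) : R :=
  ∑ p, ∑ q, N i (J p) * Q p q * y q

/-- On the rows `I` the matrix N_J Q is the identity. Hence the entries at `I` are free coordinates
on the column space, which makes the loci below graphs. -/
lemma columnForm_apply_row {R : Type*} [CommRing R] {m r : ℕ} {N : Matrix (Fin m) (Fin m) R}
    {I J : Fin r → Fin m} {Q : Matrix (Fin r) (Fin r) R} (hQ : N.submatrix I J * Q = 1)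
    (y : Fin r → R) (q : Fin r) : columnForm N J Q y (I q) = y q := by
  have h := congr_arg (fun M => (M *ᵥ y) q) hQ
  simp only [one_mulVec] at h
  rw [← h, columnForm, Finset.sum_comm]
  simp [mulVec, dotProduct, mul_apply, Finset.sum_mul]

lemma columnDefect_eq {R : Type*} [CommRing R] {m r : ℕ} (N : Matrix (Fin m) (Fin m) R)
    (I J : Fin r → Fin m) (Q : Matrix (Fin r) (Fin r) R) (u : Fin (m + 1) → R) (i : Fin m) :
    columnDefect N I J Q u i = u i.succ - columnForm N J Q (fun q => u (I q).succ) i := rfl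

lemma map_columnDefect {R S : Type*} [CommRing R] [CommRing S] (f : R →+* S) {m r : ℕ}
    (N : Matrix (Fin m) (Fin m) R) (I J : Fin r → Fin m) (Q : Matrix (Fin r) (Fin r) R)
    (u : Fin (m + 1) → R) (i : Fin m) :
    f (columnDefect N I J Q u i) = columnDefect (N.map f) I J (Q.map f) (f ∘ u) i := by
  simp [columnDefect]

lemma map_cornerDefect {R S : Type*} [CommRing R] [CommRing S] (f : R →+* S) {m r : ℕ}
    (I J : Fin r → Fin m) (Q : Matrix (Fin r) (Fin r) R) (u : Fin (m + 1) → R) :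
    f (cornerDefect I J Q u) = cornerDefect I J (Q.map f) (f ∘ u) := by
  simp [cornerDefect]

variable {m r : ℕ} (N : Matrix (Fin m) (Fin m) A)

/-- The bordered matrix of `N` with indeterminate first row. -/
def genericBordered : Matrix (Fin (m + 1)) (Fin (m + 1)) (MvPolynomial (Fin (m + 1)) A) :=
  bordered (N.map MvPolynomial.C) MvPolynomial.X

lemma genericBordered_map {L : Type*} [CommRing L] (x : MvPolynomial (Fin (m + 1)) A →+* L) :
    (genericBordered N).map x =
      bordered (N.map (x.comp MvPolynomial.C)) (x ∘ MvPolynomial.X) := by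
  rw [genericBordered, bordered_map, map_map]
  rfl

/-- With `specClass_quotient_congr`, this reduces the comparison of loci over `A` to the rank
criteria over a field. -/
lemma forall_mem_minorIdeal_genericBordered {L : Type*} [CommRing L]
    (x : MvPolynomial (Fin (m + 1)) A →+* L) (s : ℕ) :
    (∀ a ∈ (genericBordered N).minorIdeal s, x a = 0) ↔
      (bordered (N.map (x.comp MvPolynomial.C)) (x ∘ MvPolynomial.X)).minorIdeal s = ⊥ := by
  rw [← genericBordered_map, ← map_minorIdeal, Ideal.map_eq_bot_iff_le_ker]
  rfl

variable {N} {I J : Fin r → Fin m} {Q : Matrix (Fin r) (Fin r) A}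

lemma submatrix_map_mul_map {L : Type*} [CommRing L] (x : A →+* L)
    (hQ : N.submatrix I J * Q = 1) : (N.map x).submatrix I J * Q.map x = 1 := by
  have h := congr_arg x.mapMatrix hQ
  rw [map_mul, map_one] at h
  exact h

lemma schur_map_eq_zero {L : Type*} [CommRing L] (x : A →+* L)
    (hN : N.schur I J Q = 0) : (N.map x).schur I J (Q.map x) = 0 := by
  ext i j
  have h := congr_arg x (congr_fun₂ hN i j)
  rw [schur_apply] at h ⊢
  simpa using h

variable (hS : N.IsSymm) (hQ : N.submatrix I J * Q = 1) (hN : N.schur I J Q = 0)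

include hQ in
lemma specClass_genericBordered_of_le {s : ℕ} (hs : s ≤ r) :
    specClass K (MvPolynomial (Fin (m + 1)) A ⧸ (genericBordered N).minorIdeal s) = 0 := by
  have : Subsingleton (MvPolynomial (Fin (m + 1)) A ⧸ (genericBordered N).minorIdeal s) := by
    rw [Ideal.Quotient.subsingleton_iff]
    exact minorIdeal_bordered_eq_top _ (submatrix_map_mul_map MvPolynomial.C hQ) hs
  exact specClass_of_subsingleton

include hN in
lemma specClass_genericBordered_of_lt {s : ℕ} (hs : r + 2 < s) :
    specClass K (MvPolynomial (Fin (m + 1)) A ⧸ (genericBordered N).minorIdeal s) =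
      lefschetz K ^ (m + 1) * specClass K A := by
  rw [← specClass_mvPolynomial]
  refine (specClass_quotient_congr (J := ⊥) fun L _ x => ?_).trans
    (specClass_congr ((AlgEquiv.quotientBot A _).restrictScalars K))
  rw [forall_mem_minorIdeal_genericBordered,
    minorIdeal_bordered_of_lt _ (schur_map_eq_zero (x.comp MvPolynomial.C) hN) hs]
  simp

include hS hQ hN in
-- On field-valued points the locus is given by the vanishing of the column defects. These equations
-- express all entries of the border through the corner and the `r` entries at `I`, which gives an
-- affine space of dimension `r + 1`.
lemma specClass_genericBordered_add_two :
    specClass K (MvPolynomial (Fin (m + 1)) A ⧸ (genericBordered N).minorIdeal (r + 2)) =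
      lefschetz K ^ (r + 1) * specClass K A := by
  let w : Fin m → MvPolynomial (Fin (m + 1)) A :=
    columnDefect (N.map MvPolynomial.C) I J (Q.map MvPolynomial.C) MvPolynomial.X
  have h1 : specClass K (MvPolynomial (Fin (m + 1)) A ⧸ (genericBordered N).minorIdeal (r + 2)) =
      specClass K (MvPolynomial (Fin (m + 1)) A ⧸ Ideal.span (Set.range w)) := by
    refine specClass_quotient_congr fun L _ x => ?_
    rw [forall_mem_minorIdeal_genericBordered, minorIdeal_bordered_eq_bot_iff _ (hS.map _)
      (submatrix_map_mul_map (x.comp MvPolynomial.C) hQ)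
      (schur_map_eq_zero (x.comp MvPolynomial.C) hN)]
    change _ ↔ Ideal.span (Set.range w) ≤ RingHom.ker x
    rw [Ideal.span_le, Set.range_subset_iff]
    refine forall_congr' fun i => ?_
    change _ ↔ x (w i) = 0
    rw [map_columnDefect]
    rfl
  rw [h1, ← specClass_mvPolynomial]
  let f : Fin m → MvPolynomial (Fin (r + 1)) A :=
    columnForm (N.map MvPolynomial.C) J (Q.map MvPolynomial.C) fun q => .X q.succ
  have hf (q : Fin r) : f (I q) = .X q.succ :=
    columnForm_apply_row (submatrix_map_mul_map MvPolynomial.C hQ) _ q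
  let φ : MvPolynomial (Fin (m + 1)) A →ₐ[A] MvPolynomial (Fin (r + 1)) A :=
    MvPolynomial.aeval (Fin.cases (.X 0) f)
  let ψ : MvPolynomial (Fin (r + 1)) A →ₐ[A] MvPolynomial (Fin (m + 1)) A :=
    MvPolynomial.aeval (Fin.cases (.X 0) fun q => .X (I q).succ)
  have hψf (i : Fin m) : ψ (f i) = columnForm (N.map MvPolynomial.C) J (Q.map MvPolynomial.C)
      (fun q => .X (I q).succ) i := by
    simp [f, ψ, columnForm]
  refine specClass_quotient_eq_of_section _ φ ψ (fun i => ?_) (fun a ha => ?_) (fun i => ?_)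
  · cases i using Fin.cases <;> simp [φ, ψ, hf]
  · have hle : Ideal.span (Set.range w) ≤ RingHom.ker φ := by
      rw [Ideal.span_le, Set.range_subset_iff]
      intro i
      change φ (w i) = 0
      simp only [w, columnDefect, map_sub, map_sum, map_mul]
      simp only [φ, MvPolynomial.aeval_X, Fin.cases_succ, hf, sub_eq_zero]
      simp [f, columnForm]
    exact hle ha
  · cases i using Fin.cases with
    | zero => simp [φ, ψ]
    | succ i =>
      have : φ (.X i.succ) = f i := by simp [φ]
      rw [this, hψf, ← columnDefect_eq]
      exact Ideal.subset_span ⟨i, rfl⟩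

include hS hQ hN in
-- As for size `r + 2`, but the corner is now also determined, so only the `r` entries at `I` stay
-- free.
lemma specClass_genericBordered_add_one :
    specClass K (MvPolynomial (Fin (m + 1)) A ⧸ (genericBordered N).minorIdeal (r + 1)) =
      lefschetz K ^ r * specClass K A := by
  let w : Option (Fin m) → MvPolynomial (Fin (m + 1)) A := fun i =>
    i.elim (cornerDefect I J (Q.map MvPolynomial.C) MvPolynomial.X)
      (columnDefect (N.map MvPolynomial.C) I J (Q.map MvPolynomial.C) MvPolynomial.X)
  have h1 : specClass K (MvPolynomial (Fin (m + 1)) A ⧸ (genericBordered N).minorIdeal (r + 1)) =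
      specClass K (MvPolynomial (Fin (m + 1)) A ⧸ Ideal.span (Set.range w)) := by
    refine specClass_quotient_congr fun L _ x => ?_
    rw [forall_mem_minorIdeal_genericBordered, minorIdeal_bordered_eq_bot_iff' _ (hS.map _)
      (submatrix_map_mul_map (x.comp MvPolynomial.C) hQ)
      (schur_map_eq_zero (x.comp MvPolynomial.C) hN)]
    change _ ↔ Ideal.span (Set.range w) ≤ RingHom.ker x
    rw [Ideal.span_le, Set.range_subset_iff, Option.forall, and_comm]
    refine and_congr ?_ (forall_congr' fun i => ?_)
    · change _ ↔ x (cornerDefect I J (Q.map MvPolynomial.C) MvPolynomial.X) = 0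
      rw [map_cornerDefect]
      rfl
    · change _ ↔ x (columnDefect (N.map MvPolynomial.C) I J (Q.map MvPolynomial.C)
        MvPolynomial.X i) = 0
      rw [map_columnDefect]
      rfl
  rw [h1, ← specClass_mvPolynomial]
  let f : Fin m → MvPolynomial (Fin r) A :=
    columnForm (N.map MvPolynomial.C) J (Q.map MvPolynomial.C) .X
  -- The corner for which the corner defect vanishes, written in the free coordinates.
  let c : MvPolynomial (Fin r) A := ∑ p, ∑ q, f (J p) * .C (Q p q) * .X q
  have hf (q : Fin r) : f (I q) = .X q :=
    columnForm_apply_row (submatrix_map_mul_map MvPolynomial.C hQ) _ q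
  let φ : MvPolynomial (Fin (m + 1)) A →ₐ[A] MvPolynomial (Fin r) A :=
    MvPolynomial.aeval (Fin.cases c f)
  let ψ : MvPolynomial (Fin r) A →ₐ[A] MvPolynomial (Fin (m + 1)) A :=
    MvPolynomial.aeval fun q => .X (I q).succ
  have hψf (i : Fin m) : ψ (f i) = columnForm (N.map MvPolynomial.C) J (Q.map MvPolynomial.C)
      (fun q => .X (I q).succ) i := by
    simp [f, ψ, columnForm]
  have hmem (i : Fin m) : .X i.succ - ψ (f i) ∈ Ideal.span (Set.range w) := by
    rw [hψf, ← columnDefect_eq]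
    exact Ideal.subset_span ⟨some i, rfl⟩
  refine specClass_quotient_eq_of_section _ φ ψ (fun i => ?_) (fun a ha => ?_) (fun i => ?_)
  · simp [φ, ψ, hf]
  · have hle : Ideal.span (Set.range w) ≤ RingHom.ker φ := by
      rw [Ideal.span_le, Set.range_subset_iff]
      rintro (_ | i)
      · change φ (cornerDefect I J (Q.map MvPolynomial.C) MvPolynomial.X) = 0
        simp only [cornerDefect, map_sub, map_sum, map_mul]
        simp [φ, hf, c]
      · change φ (columnDefect (N.map MvPolynomial.C) I J (Q.map MvPolynomial.C)
          MvPolynomial.X i) = 0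
        simp only [columnDefect, map_sub, map_sum, map_mul]
        simp only [φ, MvPolynomial.aeval_X, Fin.cases_succ, hf, sub_eq_zero]
        simp [f, columnForm]
    exact hle ha
  · cases i using Fin.cases with
    | zero =>
      have h0 : φ (.X 0) = c := by simp [φ]
      -- In `ψ c` the entries at `J` are already expressed through those at `I`; the correction is a
      -- combination of column equations.
      have hc : .X 0 - ψ c = cornerDefect I J (Q.map MvPolynomial.C) .X +
          ∑ p, ∑ q, (.X (J p).succ - ψ (f (J p))) * (.C (Q p q) * .X (I q).succ) := by
        simp only [cornerDefect, c, map_sum, map_mul, sub_mul, Finset.sum_sub_distrib]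
        simp [ψ, mul_assoc]
      rw [h0, hc]
      refine Ideal.add_mem _ (Ideal.subset_span ⟨none, rfl⟩) ?_
      exact Ideal.sum_mem _ fun p _ => Ideal.sum_mem _ fun q _ => Ideal.mul_mem_right _ _ (hmem _)
    | succ i =>
      have : φ (.X i.succ) = f i := by simp [φ]
      rw [this]
      exact hmem i

end Matrix

end

/-! ### Summation over the rank of the block. -/

/-- A matrix whose minors are zero or invertible has a rank, attained by an invertible block. -/
lemma Matrix.exists_rank_of_minors {A : Type*} [CommRing A] [Nontrivial A] {m : ℕ}
    (N : Matrix (Fin m) (Fin m) A)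
    (h : ∀ s ≤ m, ∀ f g : Fin s → Fin m,
      (N.submatrix f g).det = 0 ∨ IsUnit (N.submatrix f g).det) :
    ∃ r ≤ m, (∃ (I J : Fin r → Fin m) (Q : Matrix (Fin r) (Fin r) A),
      N.submatrix I J * Q = 1 ∧ N.schur I J Q = 0) ∧
      (∀ t ≤ r, N.minorIdeal t = ⊤) ∧ ∀ t, r < t → N.minorIdeal t = ⊥ := by
  classical
  let P : ℕ → Prop := fun s => ∃ f g : Fin s → Fin m, IsUnit (N.submatrix f g).det
  -- Size `0` always qualifies, since the empty minor is `1`.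
  have hP : P (Nat.findGreatest P m) :=
    Nat.findGreatest_spec (m := 0) (Nat.zero_le m) ⟨Fin.elim0, Fin.elim0, by simp⟩
  have hr : Nat.findGreatest P m ≤ m := Nat.findGreatest_le m
  have hbot (t : ℕ) (ht : Nat.findGreatest P m < t) : N.minorIdeal t = ⊥ := by
    by_cases htm : t ≤ m
    · rw [← le_bot_iff, minorIdeal_le_iff]
      intro f g
      refine (h t htm f g).resolve_right fun hu => ?_
      exact Nat.findGreatest_is_greatest ht htm ⟨f, g, hu⟩
    · exact N.minorIdeal_eq_bot_of_card_lt (by simpa using htm)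
  obtain ⟨I, J, hu⟩ := hP
  have hQ : N.submatrix I J * (N.submatrix I J)⁻¹ = 1 := mul_nonsing_inv _ hu
  refine ⟨_, hr, ⟨I, J, (N.submatrix I J)⁻¹, hQ, N.schur_eq_zero hQ (hbot _ (by simp))⟩,
    fun t ht => ?_, hbot⟩
  rw [← top_le_iff]
  refine le_trans ?_ (N.minorIdeal_antitone ht)
  rw [Ideal.eq_top_of_isUnit_mem _ (N.det_submatrix_mem_minorIdeal I J) hu]

/-- The class of the space of symmetric matrices of size `m + 1` with vanishing `s × s` minors
that border a given symmetric matrix of size `m` and rank `t`. -/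
def borderingClass (K : Type u) [Field K] (m s t : ℕ) : K0Var K :=
  if t + 2 < s then lefschetz K ^ (m + 1)
  else if s = t + 2 then lefschetz K ^ (t + 1)
  else if s = t + 1 then lefschetz K ^ t
  else 0

lemma specClass_genericBordered {A : Type u} [CommRing A] [Algebra K A] [Algebra.FiniteType K A]
    {m r : ℕ} {N : Matrix (Fin m) (Fin m) A} (hS : N.IsSymm) {I J : Fin r → Fin m}
    {Q : Matrix (Fin r) (Fin r) A} (hQ : N.submatrix I J * Q = 1) (hN : N.schur I J Q = 0)
    (s : ℕ) :
    specClass K (MvPolynomial (Fin (m + 1)) A ⧸ N.genericBordered.minorIdeal s) =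
      borderingClass K m s r * specClass K A := by
  rw [borderingClass]
  split_ifs with h1 h2 h3
  · exact Matrix.specClass_genericBordered_of_lt hN h1
  · subst h2
    exact Matrix.specClass_genericBordered_add_two hS hQ hN
  · subst h3
    exact Matrix.specClass_genericBordered_add_one hS hQ hN
  · rw [zero_mul]
    exact Matrix.specClass_genericBordered_of_le hQ (by omega)

section

variable {R : Type u} [CommRing R] [Algebra K R] [Algebra.FiniteType K R]

lemma specClass_tensorProduct_minorIdeal {A : Type u} [CommRing A] [Algebra K A] [Algebra R A]
    [IsScalarTower K R A] [Algebra.FiniteType K A] {m : ℕ} (N : Matrix (Fin m) (Fin m) R) (t : ℕ) :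
    specClass K (A ⊗[R] (R ⧸ N.minorIdeal t)) =
      specClass K (A ⧸ (N.map (algebraMap R A)).minorIdeal t) := by
  rw [← Matrix.map_minorIdeal]
  exact (specClass_congr
    ((Algebra.TensorProduct.quotIdealMapEquivTensorQuot A (N.minorIdeal t)).restrictScalars K)).symm

lemma specClass_tensorProduct_genericBordered {A : Type u} [CommRing A] [Algebra K A]
    [Algebra R A] [IsScalarTower K R A] [Algebra.FiniteType K A] {m : ℕ}
    (N : Matrix (Fin m) (Fin m) R) (s : ℕ) :
    specClass K (A ⊗[R] (MvPolynomial (Fin (m + 1)) R ⧸ N.genericBordered.minorIdeal s)) =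
      specClass K (MvPolynomial (Fin (m + 1)) A ⧸
        (N.map (algebraMap R A)).genericBordered.minorIdeal s) := by
  rw [specClass_tensorProduct_quotient, Matrix.map_minorIdeal, Matrix.genericBordered_map,
    Matrix.genericBordered, Matrix.map_map]
  have h1 : (MvPolynomial.map (algebraMap R A)).comp MvPolynomial.C =
      (MvPolynomial.C (σ := Fin (m + 1))).comp (algebraMap R A) := by
    ext a
    simp
  have h2 : ⇑(MvPolynomial.map (algebraMap R A)) ∘ MvPolynomial.X =
      (MvPolynomial.X (σ := Fin (m + 1))) := by
    ext1 i
    simp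
  rw [h1, h2]
  rfl

/-- The bordered matrices with vanishing `s × s` minors, sorted by the rank of the block `N`. -/
theorem specClass_genericBordered_eq_sum {m : ℕ} {N : Matrix (Fin m) (Fin m) R} (hS : N.IsSymm)
    (s : ℕ) :
    specClass K (MvPolynomial (Fin (m + 1)) R ⧸ N.genericBordered.minorIdeal s) =
      ∑ t ∈ Finset.range (m + 2), borderingClass K m s t *
        (specClass K (R ⧸ N.minorIdeal (t + 1)) - specClass K (R ⧸ N.minorIdeal t)) := by
  let S : Set R := ⋃ t : Fin (m + 1), Set.range
    fun fg : (Fin t → Fin m) × (Fin t → Fin m) => (N.submatrix fg.1 fg.2).det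
  have hfin : S.Finite := Set.finite_iUnion fun _ => Set.finite_range _
  -- The invariant is the difference of the two sides after base change to `A`. It is additive
  -- because the coefficients `borderingClass K m s t` do not depend on `A`.
  have key := eq_zero_of_forall_zero_or_isUnit (K := K) (R := R)
    (fun A _ _ _ _ _ =>
      specClass K (A ⊗[R] (MvPolynomial (Fin (m + 1)) R ⧸ N.genericBordered.minorIdeal s)) -
      ∑ t ∈ Finset.range (m + 2), borderingClass K m s t *
        (specClass K (A ⊗[R] (R ⧸ N.minorIdeal (t + 1))) -
          specClass K (A ⊗[R] (R ⧸ N.minorIdeal t)))) ?_ hfin ?_ R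
  · rw [sub_eq_zero] at key
    have hid (B : Type u) [CommRing B] [Algebra K B] [Algebra R B] [IsScalarTower K R B]
        [Algebra.FiniteType K B] : specClass K (R ⊗[R] B) = specClass K B :=
      specClass_congr ((Algebra.TensorProduct.lid R B).restrictScalars K)
    simpa only [hid] using key
  · intro A _ _ _ _ _ f
    simp only [specClass_tensorProduct_eq_add f]
    rw [sub_add_sub_comm, ← Finset.sum_add_distrib]
    congr 1
    exact Finset.sum_congr rfl fun t _ => by ring
  · intro A _ _ _ _ _ hA
    simp only [specClass_tensorProduct_genericBordered, specClass_tensorProduct_minorIdeal]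
    rcases subsingleton_or_nontrivial A with hsub | hnt
    · have h0 (I : Ideal A) : specClass K (A ⧸ I) = 0 :=
        have : Subsingleton (A ⧸ I) := Ideal.Quotient.mk_surjective.subsingleton
        specClass_of_subsingleton
      have h1 (I : Ideal (MvPolynomial (Fin (m + 1)) A)) :
          specClass K (MvPolynomial (Fin (m + 1)) A ⧸ I) = 0 :=
        have : Subsingleton (MvPolynomial (Fin (m + 1)) A ⧸ I) :=
          Module.subsingleton A _
        specClass_of_subsingleton
      simp [h0, h1]
    · obtain ⟨r, hr, ⟨I, J, Q, hQ, hN⟩, htop, hbot⟩ :=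
        (N.map (algebraMap R A)).exists_rank_of_minors fun t ht f g => by
          have := hA (N.submatrix f g).det
            (Set.mem_iUnion.mpr ⟨⟨t, Nat.lt_succ_of_le ht⟩, (f, g), rfl⟩)
          rw [RingHom.map_det] at this
          exact this
      have h0 (t : ℕ) (ht : t ≤ r) :
          specClass K (A ⧸ (N.map (algebraMap R A)).minorIdeal t) = 0 := by
        have : Subsingleton (A ⧸ (N.map (algebraMap R A)).minorIdeal t) :=
          Ideal.Quotient.subsingleton_iff.mpr (htop t ht)
        exact specClass_of_subsingleton
      have h1 (t : ℕ) (ht : r < t) :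
          specClass K (A ⧸ (N.map (algebraMap R A)).minorIdeal t) = specClass K A := by
        rw [hbot t ht]
        exact specClass_congr ((AlgEquiv.quotientBot A A).restrictScalars K)
      -- The class of the locus of vanishing `t × t` minors jumps from `0` to the class of `A`
      -- between `t = r` and `t = r + 1`, so only the term `t = r` survives.
      rw [specClass_genericBordered (hS.map _) hQ hN, Finset.sum_eq_single r, h0 r le_rfl,
        h1 (r + 1) (by omega), sub_zero, sub_self]
      · intro t _ htr
        rcases lt_or_gt_of_ne htr with h | h
        · rw [h0 t (by omega), h0 (t + 1) (by omega), sub_zero, mul_zero]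
        · rw [h1 t (by omega), h1 (t + 1) (by omega), sub_self, mul_zero]
      · intro h
        exact absurd (Finset.mem_range.mpr (by omega)) h

end

/-! ### The recursion for symmetric matrices. -/

lemma genericSym_isSymm (n : ℕ) : (genericSym K n).IsSymm := by
  ext i j
  simp [genericSym, Sym2.eq_swap]

/-- A symmetric matrix of size `m + 1` is one of size `m` bordered by a vector. -/
def symCoordEquiv (K : Type u) [Field K] (m : ℕ) :
    SymCoord K (m + 1) ≃ₐ[K] MvPolynomial (Fin (m + 1)) (SymCoord K m) :=
  AlgEquiv.ofAlgHom
    (MvPolynomial.aeval (Sym2.lift ⟨fun i j => (genericSym K m).genericBordered i j, fun i j => by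
      cases i using Fin.cases <;> cases j using Fin.cases <;>
        simp [Matrix.genericBordered, genericSym, Sym2.eq_swap]⟩))
    (MvPolynomial.aevalTower (MvPolynomial.aeval fun p => .X (p.map Fin.succ))
      fun j => .X s(0, j))
    (by
      refine MvPolynomial.algHom_ext' (MvPolynomial.algHom_ext fun p => ?_) fun j => ?_
      · induction p using Sym2.ind with | _ i j
        simp [Matrix.genericBordered, genericSym]
      · simp [Matrix.genericBordered, genericSym])
    (by
      ext p : 1
      induction p using Sym2.ind with | _ i j
      cases i using Fin.cases <;> cases j using Fin.cases <;>
        simp [Matrix.genericBordered, genericSym, Sym2.eq_swap])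

/-- The generic symmetric matrix of size `m + 1` is the generic bordering of the generic one of size
`m`, so the summation over ranks applies with base ring `SymCoord K m`. -/
lemma symClass_succ (m s : ℕ) :
    symClass K (m + 1) s = ∑ t ∈ Finset.range (m + 2), borderingClass K m s t *
      (symClass K m (t + 1) - symClass K m t) := by
  refine Eq.trans ?_ (specClass_genericBordered_eq_sum (genericSym_isSymm m) s)
  have h : (genericSym K (m + 1)).map (symCoordEquiv K m).toRingEquiv.toRingHom =
      (genericSym K m).genericBordered := by
    ext1 i j
    change symCoordEquiv K m (.X s(i, j)) = _
    simp [symCoordEquiv]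
  refine specClass_congr (Ideal.quotientEquivAlg _ _ (symCoordEquiv K m) ?_)
  rw [← h, ← Matrix.map_minorIdeal]
  rfl

end

theorem corollary2p11 {K : Type u} [Field K] (hK : ringChar K ≠ 2) (n k : ℕ)
    (hk : 0 < k) (hkn : k ≤ n) :
    varClass (symVar K n k) =
      (lefschetz K ^ n - lefschetz K ^ (k - 1)) * varClass (symVar K (n - 1) ((k : ℤ) - 2))
      + (lefschetz K ^ k - lefschetz K ^ (k - 1)) * varClass (symVar K (n - 1) ((k : ℤ) - 1))
      + lefschetz K ^ k * varClass (symVar K (n - 1) k) := by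
  obtain ⟨m, rfl⟩ : ∃ m, n = m + 1 := ⟨n - 1, by omega⟩
  obtain ⟨k, rfl⟩ : ∃ l, k = l + 1 := ⟨k - 1, by omega⟩
  have e0 : ((k + 1 : ℕ) : ℤ) - 2 = (k : ℤ) - 1 := by omega
  have e1 : ((k + 1 : ℕ) : ℤ) - 1 = (k : ℤ) := by omega
  have e2 : (((k + 1 : ℕ) : ℤ) + 1).toNat = k + 2 := by omega
  have e3 : ((k + 1 : ℕ) : ℤ).toNat = k + 1 := by omega
  have e4 : ((k : ℤ) + 1).toNat = k + 1 := by omega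
  rw [e0, e1]
  simp only [varClass_symVar, e2, e3, e4, sub_add_cancel, Int.toNat_natCast, Nat.add_sub_cancel]
  rw [symClass_succ, symClass_succ, ← Finset.sum_sub_distrib]
  set d : ℕ → K0Var K := fun t => symClass K m (t + 1) - symClass K m t
  -- Here `k` is one less than in the theorem. For `t + 1 < k` both coefficients are 𝕃^(m+1) and
  -- cancel; for `t > k + 1` both are zero. The third condition is `t + 1 = k` so that it is never
  -- met when `k = 0`.
  have hterm (t : ℕ) : borderingClass K m (k + 2) t * d t - borderingClass K m (k + 1) t * d t =
      (if t = k + 1 then lefschetz K ^ (k + 1) * d (k + 1) else 0) +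
      (if t = k then (lefschetz K ^ (k + 1) - lefschetz K ^ k) * d k else 0) +
      (if t + 1 = k then (lefschetz K ^ (m + 1) - lefschetz K ^ k) * d t else 0) := by
    rcases lt_trichotomy (t + 1) k with h | h | h
    · simp [borderingClass, show t + 2 < k + 2 by omega, show t + 2 < k + 1 by omega,
        show t ≠ k + 1 by omega, show t ≠ k by omega, show t + 1 ≠ k by omega]
    · subst h
      simp [borderingClass, sub_mul, show t ≠ t + 1 + 1 by omega]
    · rcases (show t = k ∨ t = k + 1 ∨ k + 1 < t by omega) with h | h | h
      · subst h
        simp [borderingClass, sub_mul]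
      · subst h
        simp [borderingClass, show ¬ k + 1 + 2 ≤ k by omega, show k + 1 + 1 ≠ k by omega]
      · simp [borderingClass, show ¬ t + 2 < k + 2 by omega, show ¬ t + 2 < k + 1 by omega,
          show t ≠ k + 1 by omega, show t ≠ k by omega, show t + 1 ≠ k by omega,
          show k ≠ t by omega, show k + 1 ≠ t by omega, show k ≠ t + 1 by omega]
  -- The range reaches `m + 1`, so it contains `k + 1` even when `k = m`.
  rw [Finset.sum_congr rfl fun t _ => hterm t, Finset.sum_add_distrib, Finset.sum_add_distrib,
    Finset.sum_ite_eq' , if_pos (Finset.mem_range.mpr (by omega)),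
    Finset.sum_ite_eq', if_pos (Finset.mem_range.mpr (by omega))]
  -- When `k = 0` the left side has no term, and the right side vanishes because `(-1).toNat = 0`.
  have hlast : ∑ t ∈ Finset.range (m + 2), (if t + 1 = k then
      (lefschetz K ^ (m + 1) - lefschetz K ^ k) * d t else 0) =
      (lefschetz K ^ (m + 1) - lefschetz K ^ k) *
        (symClass K m k - symClass K m ((k : ℤ) - 1).toNat) := by
    cases k with
    | zero => simp
    | succ j =>
      simp only [Nat.add_right_cancel_iff]
      rw [Finset.sum_ite_eq', if_pos (Finset.mem_range.mpr (by omega))]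
      simp [d]
  rw [hlast]
  simp only [d]
  ring
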